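/- Let $\mathbb F\in\{\mathbb R,\mathbb C\}$. A \emph{sequence space} is a Banach space $\mathbb S\subseteq\mathbb F^{\mathbb N}$ for which the unit vectors $(e_n)_{n=1}^\infty$ form a normalized $1$-unconditional basis; it is \emph{subsymmetric} if for every increasing $\pi\colon\mathbb N\to\mathbb N$ and every $f=(a_n)_{n=1}^\infty\in\mathbb S$ the sequence $f_\pi$, with value $a_k$ at $\pi(k)$ and $0$ off the range of $\pi$, belongs to $\mathbb S$ and $\|f_\pi\|_{\mathbb S}=\|f\|_{\mathbb S}$. It satisfies a \emph{lower $r$-estimate} if there is a constant $C$ with $(\sum_k\|f_k\|_{\mathbb S}^r)^{1/r}\le C\|\sum_k f_k\|_{\mathbb S}$ for all finite families $(f_k)$ of disjointly supported elements. Let $\mathcal X=(x_n)_{n=1}^\infty$ be a Schauder basis of a Banach space $\mathbb X$ over $\mathbb F$ with coordinate functionals $(x_n^*)$, let $\mathbb S$ be a subsymmetric sequence space over $\mathbb F$, put $\Lambda_m=\|\sum_{j=1}^m e_j\|_{\mathbb S}$ ($\Lambda_0=0$), and let $\sigma=(\sigma_n)_{n=1}^\infty$ be an ordered partition of $\mathbb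 N$, i.e. a partition into nonempty finite integer intervals with $\max\sigma_n<\min\sigma_{n+1}$. For $f=(a_j)_{j=1}^\infty\in c_{00}$ put \[ v_n=\frac1{\Lambda_{|\sigma_n|}}\sum_{j\in\sigma_n}e_j,\qquad v_n^*(f)=\frac{\Lambda_{|\sigma_n|}}{|\sigma_n|}\sum_{j\in\sigma_n}a_j,\qquad Q_\sigma(f)=f-\sum_{n=1}^\infty v_n^*(f)\,v_n, \] and let $\mathbb Y[\mathcal X,\mathbb S,\sigma]$ be the completion of $c_{00}$ with respect to the norm \[ \|f\|=\|Q_\sigma(f)\|_{\mathbb S}+\Big\|\sum_{n=1}^\infty v_n^*(f)\,x_n\Big\|_{\mathbb X}. \] Suppose that there is a constant $D$ such that $\sum_{n=1}^{m-1}|\sigma_n|\le D|\sigma_m|$ for all $m\in\mathbb N$. Let $1<r<\infty$. Suppose that $\mathbb S$ satisfies a lower $r$-estimate, that $\mathcal X$ is $r$-Besselian (i.e. $x\mapsto(x_n^*(x))_{n=1}^\infty$ is bounded from $\mathbb X$ into $\ell_r$), and that $(\Lambda_m)_{m=1}^\infty$ has the upper regularity property: there is $k\in\mathbb N=\{1,2,\dots\}$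 with $\Lambda_{km}\le\frac12 k\Lambda_m$ for all $m\in\mathbb N$. Then the unit vector system of $\mathbb Y[\mathcal X,\mathbb S,\sigma]$ is $d_{1,r}(\boldsymbol w)$-Besselian, where $\boldsymbol w=(\Lambda_n-\Lambda_{n-1})_{n=1}^\infty$; that is, there are continuous functionals on $\mathbb Y[\mathcal X,\mathbb S,\sigma]$ biorthogonal to the unit vectors, the coefficient transform they define is bounded from $\mathbb Y[\mathcal X,\mathbb S,\sigma]$ into $d_{1,r}(\boldsymbol w)$, and it is injective, so that \[ \mathbb Y[\mathcal X,\mathbb S,\sigma]\subseteq d_{1,r}(\boldsymbol w)\quad\text{continuously}. \] Here, for a weight $\boldsymbol w=(w_n)$ with primitive sequence $s_n=w_1+\dots+w_n$, the space $d_{1,r}(\boldsymbol w)$ consists of all $f\in c_0$ whose non-increasing rearrangement $(a_n)_{n=1}^\infty$ satisfies $\|f\|_{d_{1,r}(\boldsymbol w)}=\big(\sum_{n=1}^\infty(s_na_n)^r\frac{w_n}{s_n}\big)^{1/r}<\infty$. -/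

import Mathlib

open Filter Topology
open scoped ENNReal NNReal

/-! Sequences are indexed by `ℕ = {0, 1, 2, …}`: the `n`-th term of a sequence is the `(n+1)`-st
term in the usual one-based numbering. The space `c₀₀` of finitely supported sequences is
`ℕ →₀ 𝕜`. -/

noncomputable section

/-! ### Sequence spaces -/

/-- A (Banach) sequence space: a linear space of scalar sequences with a complete norm, in which the
unit vectors form a normalized `1`-unconditional basis. (Continuity of the coordinates and
uniqueness of the expansions follow from `solid` and `nrm_unit`.) -/
structure SequenceSpace (𝕜 : Type*) [RCLike 𝕜] where
  /-- The sequences that belong to the space. -/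
  carrier : Submodule 𝕜 (ℕ → 𝕜)
  /-- The norm of the space. -/
  nrm : Seminorm 𝕜 carrier
  eq_zero_of_nrm : ∀ f : carrier, nrm f = 0 → f = 0
  complete : ∀ u : ℕ → carrier,
    (∀ ε : ℝ, 0 < ε → ∃ N : ℕ, ∀ m n : ℕ, N ≤ m → N ≤ n → nrm (u m - u n) < ε) →
      ∃ f : carrier, Tendsto (fun n ↦ nrm (u n - f)) atTop (𝓝 0)
  unit_mem : ∀ n : ℕ, (Pi.single n 1 : ℕ → 𝕜) ∈ carrier
  nrm_unit : ∀ n : ℕ, nrm ⟨Pi.single n 1, unit_mem n⟩ = 1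
  /-- `1`-unconditionality. -/
  solid : ∀ f g : carrier, (∀ n, ‖f.1 n‖ ≤ ‖g.1 n‖) → nrm f ≤ nrm g
  /-- `f = ∑ₙ f(n) eₙ`, with convergence of the partial sums in norm. -/
  expansion : ∀ f : carrier,
    Tendsto (fun N : ℕ ↦ nrm (f - ∑ n ∈ Finset.range N, f.1 n • ⟨Pi.single n 1, unit_mem n⟩))
      atTop (𝓝 0)

namespace SequenceSpace

variable {𝕜 : Type*} [RCLike 𝕜] (S : SequenceSpace 𝕜)

/-- The `n`-th unit vector as an element of the space. -/
def unit (n : ℕ) : S.carrier := ⟨Pi.single n 1, S.unit_mem n⟩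

/-- The inclusion of `c₀₀` in the space. -/
def ofFinsupp : (ℕ →₀ 𝕜) →ₗ[𝕜] S.carrier := Finsupp.linearCombination 𝕜 S.unit

theorem ofFinsupp_apply (f : ℕ →₀ 𝕜) : (S.ofFinsupp f : ℕ → 𝕜) = f := by
  classical
  induction f using Finsupp.induction_linear with
  | zero => simp
  | add f g hf hg => simp [map_add, hf, hg]
  | single n c =>
    ext k
    simp only [ofFinsupp, Finsupp.linearCombination_single, unit, Submodule.coe_smul,
      Pi.smul_apply, smul_eq_mul, Finsupp.single_apply, Pi.single_apply, eq_comm (a := n)]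
    split_ifs <;> simp

/-- The fundamental function `Λ_m = ‖e₁ + ⋯ + e_m‖` of the unit vector system (`Λ_0 = 0`). -/
def fund (m : ℕ) : ℝ := S.nrm (∑ j ∈ Finset.range m, S.unit j)

/-- `S` is subsymmetric: for every (strictly) increasing `π`, the sequence `f_π`, which takes the
value `f k` at `π k` and vanishes off the range of `π`, is in `S` and has the same norm as `f`. -/
def IsSubsymmetric : Prop :=
  ∀ (f : S.carrier) (π : ℕ → ℕ), StrictMono π →
    ∃ h : Function.extend π f.1 0 ∈ S.carrier, S.nrm ⟨Function.extend π f.1 0, h⟩ = S.nrm f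

/-- `S` satisfies a lower `r`-estimate: `(∑ ‖f_k‖^r)^{1/r} ≤ C ‖∑ f_k‖` for finitely many disjointly
supported `f_k`. -/
def LowerEstimate (r : ℝ) : Prop :=
  ∃ C : ℝ, ∀ (N : ℕ) (f : Fin N → S.carrier),
    Pairwise (fun i j ↦ Disjoint (Function.support (f i).1) (Function.support (f j).1)) →
      (∑ k, S.nrm (f k) ^ r) ^ (1 / r) ≤ C * S.nrm (∑ k, f k)

end SequenceSpace

/-- The upper regularity property (URP) of a sequence `(s_m)_{m ≥ 1}`. -/
def HasURP (s : ℕ → ℝ) : Prop :=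
  ∃ k : ℕ, 0 < k ∧ ∀ m : ℕ, 0 < m → s (k * m) ≤ (1 / 2) * k * s m

/-! ### Lebesgue and Lorentz quasi-norms -/

/-- The `ℓ_r`-norm of a sequence, with the value `∞` off `ℓ_r`. -/
def ellENorm {𝕜 : Type*} [RCLike 𝕜] (r : ℝ) (f : ℕ → 𝕜) : ℝ≥0∞ :=
  (∑' n, ‖f n‖ₑ ^ r) ^ (1 / r)

/-- The non-increasing rearrangement of (the moduli of) a sequence. -/
def decRearr {𝕜 : Type*} [RCLike 𝕜] (f : ℕ → 𝕜) (n : ℕ) : ℝ≥0∞ :=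
  sInf {t : ℝ≥0∞ | {k : ℕ | t < ‖f k‖ₑ}.encard ≤ n}

/-- The primitive sequence `w_1 + ⋯ + w_n` of a weight. -/
def primitive (w : ℕ → ℝ) (n : ℕ) : ℝ := ∑ i ∈ Finset.range (n + 1), w i

open Classical in
/-- The quasi-norm `(∑ₙ (s_n a_n)^q w_n / s_n)^{1/q}` of the Lorentz sequence space `d_{1,q}(w)`,
where `(s_n)` is the primitive sequence of `w` and `(a_n)` is the non-increasing rearrangement of
`f`. Since `d_{1,q}(w)` consists of null sequences, the value is `∞` off `c₀`; the space is the set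
of sequences with a finite value. -/
def lorentzENorm {𝕜 : Type*} [RCLike 𝕜] (q : ℝ) (w : ℕ → ℝ) (f : ℕ → 𝕜) : ℝ≥0∞ :=
  if Tendsto f atTop (𝓝 0) then
    (∑' n, (ENNReal.ofReal (primitive w n) * decRearr f n) ^ q *
      ENNReal.ofReal (w n / primitive w n)) ^ (1 / q)
  else ∞

/-! ### Biorthogonal systems -/

/-- A biorthogonal system in a normed space. -/
structure BiorthogonalSystem (𝕜 : Type*) [RCLike 𝕜] (E : Type*) [NormedAddCommGroup E]
    [NormedSpace 𝕜 E] where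
  vec : ℕ → E
  dual : ℕ → StrongDual 𝕜 E
  ortho : ∀ n k : ℕ, dual n (vec k) = if n = k then 1 else 0

namespace BiorthogonalSystem

variable {𝕜 : Type*} [RCLike 𝕜] {E : Type*} [NormedAddCommGroup E] [NormedSpace 𝕜 E]

/-- The coefficient transform. -/
def coeff (O : BiorthogonalSystem 𝕜 E) (x : E) : ℕ → 𝕜 := fun n ↦ O.dual n x

/-- The coefficient transform is bounded from `E` into the space `{f | ν f < ∞}` with the
quasi-norm `ν`. -/
def IsBesselian (O : BiorthogonalSystem 𝕜 E) (ν : (ℕ → 𝕜) → ℝ≥0∞) : Prop :=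
  ∃ C : ℝ≥0, ∀ x : E, ν (O.coeff x) ≤ C * ‖x‖ₑ

/-- A Schauder basis together with its dual basis. -/
def ofSchauderBasis (B : SchauderBasis 𝕜 E) : BiorthogonalSystem 𝕜 E where
  vec := B.basis
  dual := B.coord
  ortho n k := by rw [B.ortho]; simp [Pi.single_apply]

end BiorthogonalSystem

/-! ### Ordered partitions -/

/-- An ordered partition of `ℕ` into (nonempty, finite) integer intervals. -/
structure OrderedPartition where
  part : ℕ → Finset ℕ
  nonempty : ∀ n, (part n).Nonempty
  interval : ∀ n, (part n : Set ℕ).OrdConnected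
  lt_succ : ∀ n, ∀ i ∈ part n, ∀ j ∈ part (n + 1), i < j
  cover : ∀ j, ∃ n, j ∈ part n

namespace OrderedPartition

theorem lt_of_lt (σ : OrderedPartition) {m n : ℕ} (h : m < n) :
    ∀ i ∈ σ.part m, ∀ j ∈ σ.part n, i < j := by
  induction n, h using Nat.le_induction with
  | base => exact σ.lt_succ m
  | succ n _ ih =>
    intro i hi j hj
    obtain ⟨k, hk⟩ := σ.nonempty n
    exact (ih i hi k hk).trans (σ.lt_succ n k hk j hj)

theorem eq_of_mem (σ : OrderedPartition) {m n j : ℕ} (hm : j ∈ σ.part m) (hn : j ∈ σ.part n) :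
    m = n := by
  rcases lt_trichotomy m n with h | h | h
  · exact absurd (σ.lt_of_lt h j hm j hn) (lt_irrefl j)
  · exact h
  · exact absurd (σ.lt_of_lt h j hn j hm) (lt_irrefl j)

end OrderedPartition

/-! ### The DKK-method -/

section DKK

variable {𝕜 : Type*} [RCLike 𝕜] {E : Type*} [NormedAddCommGroup E] [NormedSpace 𝕜 E]

/-- `v_n = Λ_{|σ_n|}⁻¹ ∑_{j ∈ σ_n} e_j`. -/
def dkkVec (S : SequenceSpace 𝕜) (σ : OrderedPartition) (n : ℕ) : ℕ →₀ 𝕜 :=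
  (((S.fund (σ.part n).card)⁻¹ : ℝ) : 𝕜) • ∑ j ∈ σ.part n, Finsupp.single j 1

/-- `v_n^*(f) = (Λ_{|σ_n|} / |σ_n|) ∑_{j ∈ σ_n} f(j)`. -/
def dkkFun (S : SequenceSpace 𝕜) (σ : OrderedPartition) (n : ℕ) (f : ℕ →₀ 𝕜) : 𝕜 :=
  ((S.fund (σ.part n).card / (σ.part n).card : ℝ) : 𝕜) * ∑ j ∈ σ.part n, f j

theorem dkkFun_finite (S : SequenceSpace 𝕜) (σ : OrderedPartition) (f : ℕ →₀ 𝕜) :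
    (Function.support fun n ↦ dkkFun S σ n f).Finite := by
  refine (f.support.finite_toSet.biUnion (t := fun j ↦ {n | j ∈ σ.part n}) fun j _ ↦
    Set.Subsingleton.finite fun m hm n hn ↦ σ.eq_of_mem hm hn).subset fun n hn ↦ ?_
  obtain ⟨j, hj, hfj⟩ := Finset.exists_ne_zero_of_sum_ne_zero (right_ne_zero_of_mul hn)
  exact Set.mem_biUnion (Finsupp.mem_support_iff.2 hfj) hj

/-- The (finitely supported) sequence `(v_n^*(f))_n`. -/
def dkkCoeff (S : SequenceSpace 𝕜) (σ : OrderedPartition) : (ℕ →₀ 𝕜) →ₗ[𝕜] (ℕ →₀ 𝕜) where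
  toFun f := Finsupp.ofSupportFinite (fun n ↦ dkkFun S σ n f) (dkkFun_finite S σ f)
  map_add' f g := by
    ext n
    simp [Finsupp.ofSupportFinite_coe, dkkFun, Finset.sum_add_distrib, mul_add]
  map_smul' c f := by
    ext n
    simp [Finsupp.ofSupportFinite_coe, dkkFun, ← Finset.mul_sum, mul_left_comm]

/-- The averaging projection `P_σ(f) = ∑ₙ v_n^*(f) v_n` on `c₀₀`. -/
def avgProj (S : SequenceSpace 𝕜) (σ : OrderedPartition) : (ℕ →₀ 𝕜) →ₗ[𝕜] (ℕ →₀ 𝕜) :=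
  Finsupp.linearCombination 𝕜 (dkkVec S σ) ∘ₗ dkkCoeff S σ

/-- The complementary projection `Q_σ = Id - P_σ` on `c₀₀`. -/
def avgProjCompl (S : SequenceSpace 𝕜) (σ : OrderedPartition) : (ℕ →₀ 𝕜) →ₗ[𝕜] (ℕ →₀ 𝕜) :=
  LinearMap.id - avgProj S σ

/-- `‖f‖_{X,S,σ} = ‖Q_σ(f)‖_S + ‖∑ₙ v_n^*(f) x_n‖_X`. -/
def dkkNorm (B : SchauderBasis 𝕜 E) (S : SequenceSpace 𝕜) (σ : OrderedPartition)
    (f : ℕ →₀ 𝕜) : ℝ :=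
  S.nrm (S.ofFinsupp (avgProjCompl S σ f)) +
    ‖Finsupp.linearCombination 𝕜 B.basis (dkkCoeff S σ f)‖

/-- The space `c₀₀`, to be equipped with the norm `‖·‖_{X,S,σ}`. -/
def DKKPre (_B : SchauderBasis 𝕜 E) (_S : SequenceSpace 𝕜) (_σ : OrderedPartition) : Type _ :=
  ℕ →₀ 𝕜

variable (B : SchauderBasis 𝕜 E) (S : SequenceSpace 𝕜) (σ : OrderedPartition)

instance : AddCommGroup (DKKPre B S σ) := inferInstanceAs (AddCommGroup (ℕ →₀ 𝕜))

instance : Module 𝕜 (DKKPre B S σ) := inferInstanceAs (Module 𝕜 (ℕ →₀ 𝕜))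

instance : Norm (DKKPre B S σ) := ⟨dkkNorm B S σ⟩

theorem dkkNorm_smul (c : 𝕜) (f : ℕ →₀ 𝕜) :
    dkkNorm B S σ (c • f) = ‖c‖ * dkkNorm B S σ f := by
  simp [dkkNorm, map_smul, map_smul_eq_mul, norm_smul, mul_add]

theorem dkkNorm_add_le (f g : ℕ →₀ 𝕜) :
    dkkNorm B S σ (f + g) ≤ dkkNorm B S σ f + dkkNorm B S σ g := by
  simp only [dkkNorm, map_add]
  linarith [map_add_le_add S.nrm (S.ofFinsupp (avgProjCompl S σ f))
    (S.ofFinsupp (avgProjCompl S σ g)),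
    norm_add_le (Finsupp.linearCombination 𝕜 B.basis (dkkCoeff S σ f))
      (Finsupp.linearCombination 𝕜 B.basis (dkkCoeff S σ g))]

theorem dkkNorm_eq_zero_iff (f : ℕ →₀ 𝕜) : dkkNorm B S σ f = 0 ↔ f = 0 := by
  constructor
  · intro h
    obtain ⟨h1, h2⟩ := (add_eq_zero_iff_of_nonneg (apply_nonneg _ _) (norm_nonneg _)).1 h
    have h3 : dkkCoeff S σ f = 0 :=
      linearIndependent_iff.1 B.linearIndependent _ (norm_eq_zero.1 h2)
    have h4 : avgProjCompl S σ f = 0 := by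
      have := congrArg Subtype.val (S.eq_zero_of_nrm _ h1)
      rw [S.ofFinsupp_apply] at this
      exact DFunLike.coe_injective this
    simpa [avgProjCompl, avgProj, h3] using h4
  · rintro rfl
    simp [dkkNorm]

theorem dkkNorm_core : NormedSpace.Core 𝕜 (DKKPre B S σ) where
  norm_nonneg _ := add_nonneg (apply_nonneg _ _) (norm_nonneg _)
  norm_smul := dkkNorm_smul B S σ
  norm_triangle := dkkNorm_add_le B S σ
  norm_eq_zero_iff := dkkNorm_eq_zero_iff B S σ

instance : NormedAddCommGroup (DKKPre B S σ) := NormedAddCommGroup.ofCore (dkkNorm_core B S σ)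

instance : NormedSpace 𝕜 (DKKPre B S σ) := NormedSpace.ofCore (dkkNorm_core B S σ)

/-- The Banach space `Y[X, S, σ]`: the completion of `c₀₀` in the norm `‖·‖_{X,S,σ}`. -/
abbrev DKKSpace : Type _ := UniformSpace.Completion (DKKPre B S σ)

/-- The unit vector system of `Y[X, S, σ]`. -/
def DKKSpace.unit (n : ℕ) : DKKSpace B S σ :=
  ((show DKKPre B S σ from Finsupp.single n (1 : 𝕜)) : DKKSpace B S σ)

end DKK

end

/-! The coefficient sequence of `y` in the completion splits as `g + h`. Here `g` is an element of
`S`, the limit of the `Q_σ` parts. The sequence `h` is constant on each block: on `σ_n` it equals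
`c_n / Λ_{|σ_n|}`, where `c_n` are the coordinates of the synthesized vector in `X`. Moreover `‖y‖`
is the sum of the norms of `g` and of that vector (`DKKSpace.exists_decomposition`).

The `r`-th power of the Lorentz quasi-norm of a null sequence is controlled by `∑_j (2^j Λ(N_j))^r`,
with `N_j` the number of terms of modulus above `2^j` (`lorentzENorm_rpow_le_dyadicLevelSum`). Up to
a constant this sum is subadditive, so `g` and `h` are treated separately.

For `g`, the lower `r`-estimate is applied to the dyadic layers `2^j < |g| ≤ 2^(j+1)`; passing from
layers to level sets costs a factor `2` in `ℓ_r` (`dyadicLevelSum_le_of_lowerEstimate`). For `h`,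
block growth makes a level set comparable with the last block it meets, so each level is paid for by
one `c_n`, and the levels charged to a fixed `n` form a geometric series
(`dyadicLevelSum_blocks_le`). The sum `∑ |c_n|^r` is finite by the Besselian hypothesis.

For injectivity, the `c_n` are block averages of the coefficients; if all coefficients vanish, so do
the vector in `X`, then `g`, then `‖y‖`. -/

namespace SequenceSpace

/-! ### Coordinates and the fundamental function of a sequence space. -/

variable {𝕜 : Type*} [RCLike 𝕜] (S : SequenceSpace 𝕜)

theorem sum_unit_apply (A : Finset ℕ) (i : ℕ) :
    ((∑ j ∈ A, S.unit j : S.carrier) : ℕ → 𝕜) i = if i ∈ A then 1 else 0 := by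
  simp [unit, Finset.sum_apply, Pi.single_apply]

theorem norm_coord_le (f : S.carrier) (n : ℕ) : ‖f.1 n‖ ≤ S.nrm f := by
  have h : S.nrm (f.1 n • S.unit n) = ‖f.1 n‖ := by
    rw [map_smul_eq_mul]
    exact (congrArg _ (S.nrm_unit n)).trans (mul_one _)
  rw [← h]
  refine S.solid _ _ fun k ↦ ?_
  by_cases hk : k = n
  · subst hk
    simp [unit]
  · simp [unit, hk]

/-- The partial sum over `range N` stops just before `N`, so the remainder still has `N`-th
coordinate `f N`, which its norm dominates. -/
theorem tendsto_coord_zero (f : S.carrier) : Tendsto f.1 atTop (𝓝 0) := by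
  rw [tendsto_zero_iff_norm_tendsto_zero]
  refine squeeze_zero (fun _ ↦ norm_nonneg _) (fun N ↦ ?_) (S.expansion f)
  refine le_trans (le_of_eq ?_) (S.norm_coord_le _ N)
  congr 1
  have h : ∑ n ∈ Finset.range N, f.1 n * (Pi.single n 1 : ℕ → 𝕜) N = 0 :=
    Finset.sum_eq_zero fun n hn ↦ by simp [(Finset.mem_range.1 hn).ne']
  simp [h]

theorem fund_zero : S.fund 0 = 0 := by simp [fund]

theorem fund_nonneg (m : ℕ) : 0 ≤ S.fund m := apply_nonneg _ _

theorem fund_mono : Monotone S.fund := fun m n h ↦ by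
  refine S.solid _ _ fun k ↦ ?_
  rw [sum_unit_apply, sum_unit_apply]
  by_cases hk : k ∈ Finset.range m
  · have : k ∈ Finset.range n := Finset.range_mono h hk
    simp only [hk, this, if_true, le_refl]
  · simp [hk]

theorem fund_one : S.fund 1 = 1 := by
  simp only [fund, Finset.range_one, Finset.sum_singleton]
  exact S.nrm_unit 0

theorem one_le_fund {m : ℕ} (hm : 0 < m) : 1 ≤ S.fund m := S.fund_one ▸ S.fund_mono hm

variable {S}

theorem IsSubsymmetric.nrm_sum_unit (hS : S.IsSubsymmetric) (A : Finset ℕ) :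
    S.nrm (∑ j ∈ A, S.unit j) = S.fund A.card := by
  classical
  -- `π` enumerates `A` increasingly and then continues beyond `max A`, so spreading the first
  -- `A.card` unit vectors along it gives the indicator of `A`.
  set π : ℕ → ℕ := fun k ↦ if h : k < A.card then A.orderEmbOfFin rfl ⟨k, h⟩ else
    A.sup id + 1 + k with hπ
  have hmem : ∀ k, π k ∈ A ↔ k < A.card := by
    intro k
    by_cases h : k < A.card
    · simp [hπ, h]
    · have : A.sup id + 1 + k ∉ A := fun hk ↦ by
        have := Finset.le_sup (f := id) hk
        simp only [id] at this
        omega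
      simp [hπ, h, this]
  have hmono : StrictMono π := by
    intro a b hab
    by_cases hb : b < A.card
    · have ha : a < A.card := hab.trans hb
      simp only [hπ, ha, hb, dif_pos]
      exact (A.orderEmbOfFin rfl).strictMono hab
    · by_cases ha : a < A.card
      · simp only [hπ, ha, hb, dif_pos, dif_neg, not_false_iff]
        have := Finset.le_sup (f := id) (Finset.orderEmbOfFin_mem A rfl ⟨a, ha⟩)
        simp only [id] at this
        omega
      · simp only [hπ, ha, hb, dif_neg, not_false_iff]
        omega
  have hsurj : ∀ i ∈ A, ∃ k, π k = i := by
    intro i hi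
    have : i ∈ Set.range (A.orderEmbOfFin rfl) := by
      rw [Finset.range_orderEmbOfFin]
      exact hi
    obtain ⟨k, hk⟩ := this
    exact ⟨k, by simp [hπ, k.2, hk]⟩
  obtain ⟨h, hn⟩ := hS (∑ j ∈ Finset.range A.card, S.unit j) π hmono
  rw [fund, ← hn]
  congr 1
  ext i
  rw [sum_unit_apply]
  change _ = Function.extend π _ 0 i
  by_cases hi : ∃ k, π k = i
  · obtain ⟨k, rfl⟩ := hi
    rw [hmono.injective.extend_apply, sum_unit_apply]
    simp [hmem]
  · rw [Function.extend_apply' _ _ _ hi, if_neg fun h ↦ hi (hsurj i h)]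
    rfl

theorem IsSubsymmetric.fund_add_le (hS : S.IsSubsymmetric) (m n : ℕ) :
    S.fund (m + n) ≤ S.fund m + S.fund n := by
  have h : ∑ j ∈ Finset.range (m + n), S.unit j =
      ∑ j ∈ Finset.range m, S.unit j + ∑ j ∈ Finset.Ico m (m + n), S.unit j :=
    (Finset.sum_range_add_sum_Ico _ (Nat.le_add_right m n)).symm
  have h' := hS.nrm_sum_unit (Finset.Ico m (m + n))
  rw [Nat.card_Ico, Nat.add_sub_cancel_left] at h'
  rw [fund, h, ← h']
  exact map_add_le_add _ _ _

end SequenceSpace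

/-! ### Dyadic level sums and the Lorentz quasi-norm. -/

section DyadicLevels

variable {𝕜 : Type*} [RCLike 𝕜]

/-- The number of terms of a sequence whose modulus exceeds `2 ^ j`. -/
noncomputable def levelCard (F : ℕ → 𝕜) (j : ℤ) : ℕ := {k : ℕ | (2 : ℝ) ^ j < ‖F k‖}.ncard

/-- A dyadic form of the `r`-th power of the quasi-norm of a Lorentz space whose weight has
primitive sequence `Λ`. -/
noncomputable def dyadicLevelSum (r : ℝ) (Λ : ℕ → ℝ) (F : ℕ → 𝕜) : ℝ≥0∞ :=
  ∑' j : ℤ, ENNReal.ofReal ((2 : ℝ) ^ j * Λ (levelCard F j)) ^ r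

/-- Needed whenever `levelCard` is compared with another count, since `ncard` is `0` on infinite
sets. -/
theorem finite_lt_norm_of_tendsto {F : ℕ → 𝕜} (hF : Tendsto F atTop (𝓝 0)) {t : ℝ} (ht : 0 < t) :
    {k : ℕ | t < ‖F k‖}.Finite := by
  have h := (tendsto_zero_iff_norm_tendsto_zero.1 hF).eventually (gt_mem_nhds ht)
  rw [← Nat.cofinite_eq_atTop] at h
  refine Set.Finite.subset h fun k hk ↦ ?_
  simpa using (le_of_lt hk : t ≤ ‖F k‖)

theorem ofReal_rpow_eq_rpow_sub_one_mul {r : ℝ} (hr : 1 < r) (a : ℝ) :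
    ENNReal.ofReal a ^ r = ENNReal.ofReal a ^ (r - 1) * ENNReal.ofReal a := by
  conv_rhs => rw [← ENNReal.rpow_one (ENNReal.ofReal a), ← ENNReal.rpow_mul, one_mul]
  rw [← ENNReal.rpow_add_of_nonneg _ _ (by linarith) zero_le_one, sub_add_cancel]

/-- Trading `a^r / a` for `b^(r-1)` leaves the bare weight `w`, which can then be telescoped. -/
theorem ofReal_mul_rpow_weight_le {r a b w : ℝ} (hr : 1 < r) (ha : 0 < a) (hab : a ≤ b) :
    ENNReal.ofReal a ^ r * ENNReal.ofReal (w / a) ≤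
      ENNReal.ofReal b ^ (r - 1) * ENNReal.ofReal w := by
  rw [ofReal_rpow_eq_rpow_sub_one_mul hr, mul_assoc, ← ENNReal.ofReal_mul ha.le, mul_div_cancel₀ _ ha.ne']
  gcongr

theorem exists_dyadic_le_decRearr {F : ℕ → 𝕜} (hF : Tendsto F atTop (𝓝 0)) (n : ℕ)
    (h0 : decRearr F n ≠ 0) :
    ∃ j : ℤ, n < levelCard F j ∧ decRearr F n ≤ ENNReal.ofReal (2 * 2 ^ j) := by
  have htop : decRearr F n ≠ ∞ := by
    obtain ⟨M, hM⟩ := (Metric.isBounded_range_of_tendsto F hF).exists_norm_le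
    refine ne_top_of_le_ne_top (ENNReal.ofReal_ne_top (r := M)) (sInf_le ?_)
    have : {k : ℕ | ENNReal.ofReal M < ‖F k‖ₑ} = ∅ := by
      -- A bound `M` for the whole sequence is exceeded by no term, hence is admissible in the
      -- infimum.
      refine Set.eq_empty_of_forall_notMem fun k hk ↦ ?_
      rw [Set.mem_ofPred_eq, ← ofReal_norm] at hk
      exact not_lt_of_ge (ENNReal.ofReal_le_ofReal (hM _ (Set.mem_range_self k))) hk
    simp [this]
  obtain ⟨j, hj1, hj2⟩ := exists_mem_Ioc_zpow (ENNReal.toReal_pos h0 htop) one_lt_two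
  have hj0 : (0 : ℝ) < 2 ^ j := by positivity
  refine ⟨j, ?_, ?_⟩
  · have hlt : ENNReal.ofReal (2 ^ j) < decRearr F n :=
      (ENNReal.ofReal_lt_iff_lt_toReal hj0.le htop).2 hj1
    have := notMem_of_lt_csInf' hlt
    have hset : {k : ℕ | ENNReal.ofReal (2 ^ j) < ‖F k‖ₑ} = {k | (2 : ℝ) ^ j < ‖F k‖} := by
      ext k
      rw [Set.mem_ofPred_eq, Set.mem_ofPred_eq, ← ofReal_norm,
        ENNReal.ofReal_lt_ofReal_iff_of_nonneg hj0.le]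
    rw [Set.mem_ofPred_eq, hset, ← (finite_lt_norm_of_tendsto hF hj0).cast_ncard_eq, not_le] at this
    exact_mod_cast this
  · rw [← zpow_one_add₀ two_ne_zero, add_comm]
    exact (ENNReal.le_ofReal_iff_toReal_le htop (by positivity)).2 hj2

/-- Each index `n` is charged to the level `j` with `2^j < a_n ≤ 2^(j+1)`, for which `n < N_j`.
After exchanging the sums, the increments of `Λ` over `n < N_j` telescope to `Λ(N_j)`. -/
theorem lorentzENorm_rpow_le_dyadicLevelSum {r : ℝ} (hr : 1 < r) {Λ : ℕ → ℝ} (hmono : Monotone Λ)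
    (h0 : Λ 0 = 0) (hpos : ∀ n, 0 < n → 0 < Λ n) {F : ℕ → 𝕜} (hF : Tendsto F atTop (𝓝 0)) :
    lorentzENorm r (fun n ↦ Λ (n + 1) - Λ n) F ^ r ≤ 2 ^ r * dyadicLevelSum r Λ F := by
  have hr0 : 0 < r := by linarith
  have hnn : ∀ n, 0 ≤ Λ n := fun n ↦ h0 ▸ hmono (Nat.zero_le n)
  have hw : ∀ n, 0 ≤ Λ (n + 1) - Λ n := fun n ↦ sub_nonneg.2 (hmono n.le_succ)
  have hprim : ∀ n, primitive (fun n ↦ Λ (n + 1) - Λ n) n = Λ (n + 1) := fun n ↦ by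
    rw [primitive, Finset.sum_range_sub, h0, sub_zero]
  rw [lorentzENorm, if_pos hF, ← ENNReal.rpow_mul, one_div_mul_cancel hr0.ne', ENNReal.rpow_one]
  simp only [hprim]
  set T : ℕ → ℤ → ℝ≥0∞ := fun n j ↦ if n < levelCard F j then
    ENNReal.ofReal (2 * 2 ^ j) ^ r * (ENNReal.ofReal (Λ (levelCard F j)) ^ (r - 1) *
      ENNReal.ofReal (Λ (n + 1) - Λ n)) else 0 with hT
  have hterm : ∀ n, (ENNReal.ofReal (Λ (n + 1)) * decRearr F n) ^ r *
      ENNReal.ofReal ((Λ (n + 1) - Λ n) / Λ (n + 1)) ≤ ∑' j, T n j := by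
    intro n
    by_cases hz : decRearr F n = 0
    · simp [hz, hr0]
    obtain ⟨j, hj, hle⟩ := exists_dyadic_le_decRearr hF n hz
    refine le_trans ?_ (ENNReal.le_tsum j)
    simp only [hT, if_pos hj]
    rw [mul_comm (ENNReal.ofReal _), ENNReal.mul_rpow_of_nonneg _ _ hr0.le, mul_assoc]
    refine mul_le_mul' (ENNReal.rpow_le_rpow hle hr0.le) ?_
    exact ofReal_mul_rpow_weight_le hr (hpos _ n.succ_pos) (hmono hj)
  refine (ENNReal.tsum_le_tsum hterm).trans ?_
  rw [ENNReal.tsum_comm, dyadicLevelSum, ← ENNReal.tsum_mul_left]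
  refine ENNReal.tsum_le_tsum fun j ↦ ?_
  set N := levelCard F j
  have h1 : ∑' n, T n j = ∑ n ∈ Finset.range N, T n j :=
    tsum_eq_sum fun n hn ↦ if_neg fun h ↦ hn (Finset.mem_range.2 h)
  have h2 : ∑ n ∈ Finset.range N, T n j = ENNReal.ofReal (2 * 2 ^ j) ^ r *
      (ENNReal.ofReal (Λ N) ^ (r - 1) * ENNReal.ofReal (Λ N)) := by
    rw [Finset.sum_congr rfl fun n hn ↦ if_pos (Finset.mem_range.1 hn), ← Finset.mul_sum,
      ← Finset.mul_sum, ← ENNReal.ofReal_sum_of_nonneg fun n _ ↦ hw n, Finset.sum_range_sub, h0,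
      sub_zero]
  rw [h1, h2, ← ofReal_rpow_eq_rpow_sub_one_mul hr, ENNReal.ofReal_mul zero_le_two, ENNReal.ofReal_mul (by positivity),
    ENNReal.mul_rpow_of_nonneg _ _ hr0.le, ENNReal.mul_rpow_of_nonneg _ _ hr0.le, mul_assoc]
  simp

theorem levelCard_add_le {F G : ℕ → 𝕜} (hF : Tendsto F atTop (𝓝 0)) (hG : Tendsto G atTop (𝓝 0))
    (j : ℤ) : levelCard (F + G) (j + 1) ≤ levelCard F j + levelCard G j := by
  have hj : (0 : ℝ) < 2 ^ j := by positivity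
  refine (Set.ncard_le_ncard ?_ ((finite_lt_norm_of_tendsto hF hj).union
    (finite_lt_norm_of_tendsto hG hj))).trans (Set.ncard_union_le _ _)
  intro k hk
  rw [Set.mem_ofPred_eq, zpow_add_one₀ two_ne_zero] at hk
  have := norm_add_le (F k) (G k)
  by_contra! h
  simp only [Set.mem_union, Set.mem_ofPred_eq, not_or, not_lt] at h
  rw [Pi.add_apply] at hk
  linarith

theorem dyadicLevelSum_add_le {r : ℝ} (hr : 1 < r) {Λ : ℕ → ℝ} (hmono : Monotone Λ)
    (hadd : ∀ m n, Λ (m + n) ≤ Λ m + Λ n) (hnn : ∀ n, 0 ≤ Λ n) {F G : ℕ → 𝕜}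
    (hF : Tendsto F atTop (𝓝 0)) (hG : Tendsto G atTop (𝓝 0)) :
    dyadicLevelSum r Λ (F + G) ≤
      2 ^ r * 2 ^ (r - 1) * (dyadicLevelSum r Λ F + dyadicLevelSum r Λ G) := by
  -- Level `j + 1` of the sum is compared with level `j` of the summands. The shift yields the
  -- factor `2^r`, convexity of the power the factor `2^(r-1)`.
  rw [dyadicLevelSum, ← (Equiv.addRight (1 : ℤ)).tsum_eq, dyadicLevelSum, dyadicLevelSum,
    ← ENNReal.tsum_add, ← ENNReal.tsum_mul_left]
  refine ENNReal.tsum_le_tsum fun j ↦ ?_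
  have hj : (0 : ℝ) < 2 ^ j := by positivity
  rw [Equiv.coe_addRight, mul_assoc]
  calc ENNReal.ofReal (2 ^ (j + 1) * Λ (levelCard (F + G) (j + 1))) ^ r
      ≤ (2 * (ENNReal.ofReal (2 ^ j * Λ (levelCard F j)) +
          ENNReal.ofReal (2 ^ j * Λ (levelCard G j)))) ^ r := by
        gcongr
        rw [← ENNReal.ofReal_add (mul_nonneg hj.le (hnn _)) (mul_nonneg hj.le (hnn _)),
          ← ENNReal.ofReal_ofNat 2, ← ENNReal.ofReal_mul zero_le_two]
        refine ENNReal.ofReal_le_ofReal ?_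
        have := (hmono (levelCard_add_le hF hG j)).trans (hadd _ _)
        rw [zpow_add_one₀ two_ne_zero]
        nlinarith
    _ ≤ _ := by
        rw [ENNReal.mul_rpow_of_nonneg _ _ (by linarith)]
        gcongr
        exact ENNReal.rpow_add_le_mul_rpow_add_rpow _ _ hr.le

theorem le_mul_of_subadditive {Λ : ℕ → ℝ} (h0 : Λ 0 = 0) (hadd : ∀ m n, Λ (m + n) ≤ Λ m + Λ n)
    (K n : ℕ) : Λ (K * n) ≤ K * Λ n := by
  induction K with
  | zero => simp [h0]
  | succ K ih =>
    rw [Nat.succ_mul]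
    push_cast
    linarith [hadd (K * n) n]

theorem sum_zpow_le {b : ℝ} (hb : 0 ≤ b) (s : Finset ℤ) (hs : ∀ j ∈ s, (2 : ℝ) ^ j < b) :
    ∑ j ∈ s, (2 : ℝ) ^ j ≤ 2 * b := by
  rcases s.eq_empty_or_nonempty with rfl | hne
  · simpa using hb
  have hmax := hs _ (s.max'_mem hne)
  set J := s.max' hne
  have hinj : Set.InjOn (fun j : ℤ ↦ (J - j).toNat) s := by
    intro i hi j hj hij
    have h1 := s.le_max' i hi
    have h2 := s.le_max' j hj
    simp only at hij
    omega
  have h1 : ∑ j ∈ s, (2 : ℝ) ^ j = 2 ^ J * ∑ i ∈ s.image (fun j : ℤ ↦ (J - j).toNat),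
      (1 / 2 : ℝ) ^ i := by
    rw [Finset.sum_image hinj, Finset.mul_sum]
    refine Finset.sum_congr rfl fun j hj ↦ ?_
    have h2 := s.le_max' j hj
    rw [← zpow_natCast, Int.toNat_of_nonneg (sub_nonneg.2 h2), one_div, inv_zpow', ← zpow_add₀
      two_ne_zero]
    congr 1
    ring
  have h2 : ∑ i ∈ s.image (fun j : ℤ ↦ (J - j).toNat), (1 / 2 : ℝ) ^ i ≤ 2 :=
    (summable_geometric_two.sum_le_tsum _ fun i _ ↦ by positivity).trans tsum_geometric_two.le
  rw [h1]
  nlinarith [(by positivity : (0 : ℝ) < 2 ^ J)]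

/-- Bounding `r - 1` of the powers by `b` leaves a plain geometric sum, and the constant `2` does
not depend on `r`. -/
theorem tsum_zpow_rpow_le {r : ℝ} (hr : 1 < r) {b : ℝ} (hb : 0 ≤ b) :
    ∑' j : ℤ, (if (2 : ℝ) ^ j < b then ENNReal.ofReal (2 ^ j) ^ r else 0) ≤
      2 * ENNReal.ofReal b ^ r := by
  refine ENNReal.summable.tsum_le_of_sum_le fun s ↦ ?_
  rw [← Finset.sum_filter]
  calc _ ≤ ∑ j ∈ s with (2 : ℝ) ^ j < b, ENNReal.ofReal b ^ (r - 1) * ENNReal.ofReal (2 ^ j) := by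
        refine Finset.sum_le_sum fun j hj ↦ ?_
        rw [ofReal_rpow_eq_rpow_sub_one_mul hr]
        have := (Finset.mem_filter.1 hj).2.le
        gcongr
    _ ≤ _ := by
        rw [← Finset.mul_sum, ← ENNReal.ofReal_sum_of_nonneg fun j _ ↦ by positivity,
          ofReal_rpow_eq_rpow_sub_one_mul hr b,
          mul_left_comm, ← ENNReal.ofReal_ofNat 2, ← ENNReal.ofReal_mul zero_le_two]
        gcongr
        exact sum_zpow_le hb _ fun j hj ↦ (Finset.mem_filter.1 hj).2

end DyadicLevels

/-! ### Sequences of constant modulus on the blocks of a partition. -/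

namespace OrderedPartition

/-- The index of the part that contains a given number. -/
noncomputable def index (σ : OrderedPartition) (j : ℕ) : ℕ := (σ.cover j).choose

theorem mem_part_index (σ : OrderedPartition) (j : ℕ) : j ∈ σ.part (σ.index j) :=
  (σ.cover j).choose_spec

theorem index_eq (σ : OrderedPartition) {j n : ℕ} (h : j ∈ σ.part n) : σ.index j = n :=
  σ.eq_of_mem (σ.mem_part_index j) h

theorem index_mono (σ : OrderedPartition) : Monotone σ.index := fun i j h ↦ by
  by_contra! hlt
  exact absurd (σ.lt_of_lt hlt _ (σ.mem_part_index j) _ (σ.mem_part_index i)) (not_lt.2 h)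

theorem tendsto_index (σ : OrderedPartition) : Tendsto σ.index atTop atTop :=
  tendsto_atTop_atTop_of_monotone σ.index_mono fun n ↦ by
    obtain ⟨j, hj⟩ := σ.nonempty n
    exact ⟨j, (σ.index_eq hj).ge⟩

theorem card_pos (σ : OrderedPartition) (n : ℕ) : 0 < (σ.part n).card := (σ.nonempty n).card_pos

end OrderedPartition

section Blocks

variable {𝕜 : Type*} [RCLike 𝕜]

/-- If `m` is the last block that a level set meets, the set lies in the blocks up to `m`, hence has
at most `K |σ_m|` elements, while `2^j` is below the value `b m` on that block. Summing over the
levels below each `b n` gives at most `2 b_n^r`, and `Λ_{|σ_n|} b_n = |c_n|`. -/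
theorem dyadicLevelSum_blocks_le {r : ℝ} (hr : 1 < r) {Λ : ℕ → ℝ} (hmono : Monotone Λ)
    (h0 : Λ 0 = 0) (hadd : ∀ m n, Λ (m + n) ≤ Λ m + Λ n) (hpos : ∀ n, 0 < n → 0 < Λ n)
    (σ : OrderedPartition) {K : ℕ}
    (hK : ∀ m, ∑ n ∈ Finset.range (m + 1), (σ.part n).card ≤ K * (σ.part m).card)
    {c h : ℕ → 𝕜} (hh : Tendsto h atTop (𝓝 0))
    (hch : ∀ j, ‖h j‖ = ‖c (σ.index j)‖ / Λ (σ.part (σ.index j)).card) :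
    dyadicLevelSum r Λ h ≤ (K : ℝ≥0∞) ^ r * (2 * ∑' n, ‖c n‖ₑ ^ r) := by
  have hr0 : 0 < r := by linarith
  have hΛ : ∀ n, 0 < Λ (σ.part n).card := fun n ↦ hpos _ (σ.card_pos n)
  set b : ℕ → ℝ := fun n ↦ ‖c n‖ / Λ (σ.part n).card with hb
  set T : ℕ → ℤ → ℝ≥0∞ := fun n j ↦ if (2 : ℝ) ^ j < b n then
    ENNReal.ofReal (2 ^ j) ^ r else 0 with hT
  have hterm : ∀ j : ℤ, ENNReal.ofReal (2 ^ j * Λ (levelCard h j)) ^ r ≤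
      (K : ℝ≥0∞) ^ r * ∑' n, ENNReal.ofReal (Λ (σ.part n).card) ^ r * T n j := by
    intro j
    have hj : (0 : ℝ) < 2 ^ j := by positivity
    have hfin := finite_lt_norm_of_tendsto hh hj
    rcases Set.eq_empty_or_nonempty {k : ℕ | (2 : ℝ) ^ j < ‖h k‖} with he | hne
    · simp [levelCard, he, h0, hr0]
    obtain ⟨k, hk, hmax⟩ := Set.exists_max_image _ id hfin hne
    set m := σ.index k
    have hcard : levelCard h j ≤ K * (σ.part m).card := by
      refine le_trans ?_ ((Finset.card_biUnion_le (s := Finset.range (m + 1))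
        (t := σ.part)).trans (hK m))
      rw [← Set.ncard_coe_finset]
      refine Set.ncard_le_ncard (fun i hi ↦ ?_) (Finset.finite_toSet _)
      simp only [Finset.coe_biUnion, Set.mem_iUnion]
      exact ⟨σ.index i, by simpa using Nat.lt_succ_of_le (σ.index_mono (hmax i hi)),
        σ.mem_part_index i⟩
    have hle : Λ (levelCard h j) ≤ K * Λ (σ.part m).card :=
      (hmono hcard).trans (le_mul_of_subadditive h0 hadd _ _)
    have hbm : (2 : ℝ) ^ j < b m := lt_of_lt_of_eq hk (hch k)
    calc ENNReal.ofReal (2 ^ j * Λ (levelCard h j)) ^ r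
        ≤ ENNReal.ofReal (K * (Λ (σ.part m).card * 2 ^ j)) ^ r := by
          refine ENNReal.rpow_le_rpow (ENNReal.ofReal_le_ofReal ?_) hr0.le
          linarith [mul_le_mul_of_nonneg_left hle hj.le]
      _ = (K : ℝ≥0∞) ^ r * (ENNReal.ofReal (Λ (σ.part m).card) ^ r * T m j) := by
          simp only [hT, if_pos hbm]
          rw [ENNReal.ofReal_mul (Nat.cast_nonneg K), ENNReal.ofReal_mul (hΛ m).le,
            ENNReal.mul_rpow_of_nonneg _ _ hr0.le, ENNReal.mul_rpow_of_nonneg _ _ hr0.le,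
            ENNReal.ofReal_natCast]
      _ ≤ _ := by
          gcongr
          exact ENNReal.le_tsum m
  refine (ENNReal.tsum_le_tsum hterm).trans ?_
  rw [ENNReal.tsum_mul_left, ENNReal.tsum_comm]
  refine mul_le_mul' le_rfl ?_
  rw [← ENNReal.tsum_mul_left]
  refine ENNReal.tsum_le_tsum fun n ↦ ?_
  rw [ENNReal.tsum_mul_left]
  have hb0 : 0 ≤ b n := div_nonneg (norm_nonneg _) (hΛ n).le
  refine (mul_le_mul' le_rfl (tsum_zpow_rpow_le hr hb0)).trans (le_of_eq ?_)
  rw [mul_left_comm, ← ENNReal.mul_rpow_of_nonneg _ _ hr0.le, ← ENNReal.ofReal_mul (hΛ n).le,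
    mul_div_cancel₀ _ (hΛ n).ne', ofReal_norm]

end Blocks

/-! ### The dyadic level sum of an element of `S`. -/

theorem sum_rpow_le_of_le_add_half {r : ℝ} (hr : 1 ≤ r) {x u : ℕ → ℝ} (hx : ∀ i, 0 ≤ x i)
    (hu : ∀ i, 0 ≤ u i) {N : ℕ} (hN : x N = 0) (h : ∀ i, x i ≤ u i + 1 / 2 * x (i + 1)) :
    (∑ i ∈ Finset.range N, x i ^ r) ^ (1 / r) ≤
      2 * (∑ i ∈ Finset.range N, u i ^ r) ^ (1 / r) := by
  have hr0 : 0 < r := by linarith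
  have hxr : ∀ i, 0 ≤ x i ^ r := fun i ↦ Real.rpow_nonneg (hx i) r
  have h1 : (∑ i ∈ Finset.range N, x i ^ r) ^ (1 / r) ≤
      (∑ i ∈ Finset.range N, (u i + 1 / 2 * x (i + 1)) ^ r) ^ (1 / r) :=
    Real.rpow_le_rpow (Finset.sum_nonneg fun i _ ↦ hxr i)
      (Finset.sum_le_sum fun i _ ↦ Real.rpow_le_rpow (hx i) (h i) hr0.le) (by positivity)
  have h2 := Real.Lp_add_le_of_nonneg (s := Finset.range N) (f := u)
    (g := fun i ↦ 1 / 2 * x (i + 1)) hr (fun i _ ↦ hu i)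
    (fun i _ ↦ mul_nonneg (by norm_num) (hx _))
  have h3 : (∑ i ∈ Finset.range N, (1 / 2 * x (i + 1)) ^ r) ^ (1 / r) ≤
      1 / 2 * (∑ i ∈ Finset.range N, x i ^ r) ^ (1 / r) := by
    have h4 : ∑ i ∈ Finset.range N, (1 / 2 * x (i + 1)) ^ r =
        (1 / 2) ^ r * ∑ i ∈ Finset.range N, x (i + 1) ^ r := by
      rw [Finset.mul_sum]
      exact Finset.sum_congr rfl fun i _ ↦ Real.mul_rpow (by norm_num) (hx _)
    have h5 : ∑ i ∈ Finset.range N, x (i + 1) ^ r ≤ ∑ i ∈ Finset.range N, x i ^ r := by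
      have h6 := Finset.sum_range_succ' (fun i ↦ x i ^ r) N
      rw [Finset.sum_range_succ, hN, Real.zero_rpow hr0.ne'] at h6
      linarith [hxr 0]
    rw [h4, Real.mul_rpow (by positivity) (Finset.sum_nonneg fun i _ ↦ hxr _),
      ← Real.rpow_mul (by norm_num), mul_one_div_cancel hr0.ne', Real.rpow_one]
    exact mul_le_mul_of_nonneg_left (Real.rpow_le_rpow (Finset.sum_nonneg fun i _ ↦ hxr _) h5
      (by positivity)) (by norm_num)
  linarith

namespace SequenceSpace

variable {𝕜 : Type*} [RCLike 𝕜] {S : SequenceSpace 𝕜}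

/-- The coordinate projection of `g` on a finite set. -/
def restrict (g : S.carrier) (A : Finset ℕ) : S.carrier := ∑ i ∈ A, g.1 i • S.unit i

theorem restrict_apply (g : S.carrier) (A : Finset ℕ) (k : ℕ) :
    (restrict g A).1 k = if k ∈ A then g.1 k else 0 := by
  simp [restrict, unit, Finset.sum_apply, Pi.single_apply]

theorem nrm_sum_restrict_le (g : S.carrier) {ι : Type*} (s : Finset ι) (A : ι → Finset ℕ)
    (hA : (s : Set ι).PairwiseDisjoint A) : S.nrm (∑ i ∈ s, restrict g (A i)) ≤ S.nrm g := by
  classical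
  refine S.solid _ _ fun k ↦ ?_
  have h : (∑ i ∈ s, restrict g (A i)).1 k = (restrict g (s.biUnion A)).1 k := by
    rw [restrict, Finset.sum_biUnion hA]
    rfl
  rw [h, restrict_apply]
  split_ifs <;> simp

theorem IsSubsymmetric.mul_fund_card_le (hS : S.IsSubsymmetric) (g : S.carrier) {t : ℝ}
    (ht : 0 ≤ t) (A : Finset ℕ) (hA : ∀ k ∈ A, t ≤ ‖g.1 k‖) :
    t * S.fund A.card ≤ S.nrm (restrict g A) := by
  have h : S.nrm ((t : 𝕜) • ∑ j ∈ A, S.unit j) = t * S.fund A.card := by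
    rw [map_smul_eq_mul, hS.nrm_sum_unit, RCLike.norm_of_nonneg ht]
  rw [← h]
  refine S.solid _ _ fun k ↦ ?_
  rw [restrict_apply, Submodule.coe_smul, Pi.smul_apply, sum_unit_apply]
  split_ifs with hk
  · simpa [abs_of_nonneg ht] using hA k hk
  · simp

/-- A level set is its dyadic layer together with the next level set, so subadditivity of `Λ` gives
`x_j ≤ u_j + x_{j+1} / 2` for `x_j = 2^j Λ(N_j)`. Minkowski's inequality absorbs the last term. The
`u_j` are bounded by the norms of the disjoint layers of `g`. -/
theorem dyadicLevelSum_le_of_lowerEstimate (hS : S.IsSubsymmetric) {r : ℝ} (hr : 1 < r)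
    (hSr : S.LowerEstimate r) :
    ∃ C : ℝ≥0, ∀ g : S.carrier,
      dyadicLevelSum r S.fund g.1 ≤ (C * ENNReal.ofReal (S.nrm g)) ^ r := by
  have hr0 : 0 < r := by linarith
  obtain ⟨C, hC⟩ := hSr
  -- The `2` comes from absorbing the shifted term; the modulus is there because `C` is not assumed
  -- nonnegative.
  refine ⟨Real.toNNReal (2 * |C|), fun g ↦ ?_⟩
  have hg := S.tendsto_coord_zero g
  have hfin : ∀ j : ℤ, {k : ℕ | (2 : ℝ) ^ j < ‖g.1 k‖ ∧ ‖g.1 k‖ ≤ 2 ^ (j + 1)}.Finite := fun j ↦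
    (finite_lt_norm_of_tendsto hg (by positivity)).subset fun k hk ↦ hk.1
  set A : ℤ → Finset ℕ := fun j ↦ (hfin j).toFinset with hA
  have hmem : ∀ j k, k ∈ A j ↔ (2 : ℝ) ^ j < ‖g.1 k‖ ∧ ‖g.1 k‖ ≤ 2 ^ (j + 1) := fun j k ↦ by
    simp [hA]
  have hdisj : Pairwise fun i j ↦ Disjoint (A i) (A j) := by
    have key : ∀ i j, i < j → Disjoint (A i) (A j) := fun i j hij ↦ by
      refine Finset.disjoint_left.2 fun k hi hj ↦ ?_
      have h1 := ((hmem _ _).1 hi).2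
      have h2 := ((hmem _ _).1 hj).1
      exact absurd (h2.trans_le h1) (not_lt.2 (zpow_le_zpow_right₀ one_le_two hij))
    intro i j hij
    rcases lt_or_gt_of_ne hij with h | h
    · exact key _ _ h
    · exact (key _ _ h).symm
  have hlevel : ∀ j, levelCard g.1 j ≤ (A j).card + levelCard g.1 (j + 1) := fun j ↦ by
    rw [← Set.ncard_coe_finset, levelCard, levelCard]
    refine (Set.ncard_le_ncard (fun k hk ↦ ?_) ((Finset.finite_toSet _).union
      (finite_lt_norm_of_tendsto hg (by positivity)))).trans (Set.ncard_union_le _ _)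
    rcases le_or_gt ‖g.1 k‖ (2 ^ (j + 1)) with h | h
    · exact Or.inl ((hmem _ _).2 ⟨hk, h⟩)
    · exact Or.inr h
  -- Empty high levels supply the terminal condition `x N = 0` of the recursion.
  have hvanish : ∃ M : ℕ, ∀ j : ℤ, M ≤ j → levelCard g.1 j = 0 := by
    obtain ⟨M, hM⟩ := pow_unbounded_of_one_lt (S.nrm g) (one_lt_two (α := ℝ))
    refine ⟨M, fun j hj ↦ ?_⟩
    have : {k : ℕ | (2 : ℝ) ^ j < ‖g.1 k‖} = ∅ := by
      refine Set.eq_empty_of_forall_notMem fun k (hk : (2 : ℝ) ^ j < ‖g.1 k‖) ↦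
        not_le_of_gt hk ?_
      refine (S.norm_coord_le g k).trans (hM.le.trans ?_)
      rw [← zpow_natCast]
      exact zpow_le_zpow_right₀ one_le_two hj
    rw [levelCard, this, Set.ncard_empty]
  obtain ⟨M, hM⟩ := hvanish
  have hfinite : ∀ (a : ℤ) (N : ℕ), (M : ℤ) ≤ a + N →
      ∑ i ∈ Finset.range N, ((2 : ℝ) ^ (a + i) * S.fund (levelCard g.1 (a + i))) ^ r ≤
        (2 * |C| * S.nrm g) ^ r := by
    intro a N hN
    set x : ℕ → ℝ := fun i ↦ (2 : ℝ) ^ (a + i) * S.fund (levelCard g.1 (a + i)) with hx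
    set u : ℕ → ℝ := fun i ↦ (2 : ℝ) ^ (a + i) * S.fund (A (a + i)).card with hu
    have hx0 : ∀ i, 0 ≤ x i := fun i ↦ mul_nonneg (by positivity) (S.fund_nonneg _)
    have hu0 : ∀ i, 0 ≤ u i := fun i ↦ mul_nonneg (by positivity) (S.fund_nonneg _)
    have hxu : ∀ i, x i ≤ u i + 1 / 2 * x (i + 1) := fun i ↦ by
      have h1 := (S.fund_mono (hlevel (a + i))).trans (hS.fund_add_le _ _)
      have h2 := mul_le_mul_of_nonneg_left h1 (by positivity : (0 : ℝ) ≤ 2 ^ (a + i))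
      have h3 : (2 : ℝ) ^ (a + (i : ℤ) + 1) = 2 ^ (a + (i : ℤ)) * 2 := zpow_add_one₀ two_ne_zero _
      simp only [hx, hu]
      push_cast
      rw [← add_assoc, h3]
      linarith
    have hxN : x N = 0 := by simp [hx, hM _ hN, fund_zero]
    have h1 := sum_rpow_le_of_le_add_half hr.le hx0 hu0 hxN hxu
    have hinj : ∀ i j : Fin N, i ≠ j → a + ((i : ℕ) : ℤ) ≠ a + ((j : ℕ) : ℤ) := fun i j hij h ↦
      hij (Fin.ext (by omega))
    have h2 := hC N (fun i ↦ restrict g (A (a + ((i : ℕ) : ℤ)))) (by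
      intro i j hij
      refine Set.disjoint_left.2 fun k hi hj ↦ ?_
      simp only [Function.mem_support, restrict_apply, ne_eq, ite_eq_right_iff, not_forall]
        at hi hj
      exact Finset.disjoint_left.1 (hdisj (hinj i j hij)) hi.1 hj.1)
    have h3 : S.nrm (∑ i : Fin N, restrict g (A (a + ((i : ℕ) : ℤ)))) ≤ S.nrm g :=
      nrm_sum_restrict_le g _ (fun i : Fin N ↦ A (a + ((i : ℕ) : ℤ)))
        fun i _ j _ hij ↦ hdisj (hinj i j hij)
    have h4 : (∑ i ∈ Finset.range N, u i ^ r) ^ (1 / r) ≤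
        (∑ i : Fin N, S.nrm (restrict g (A (a + ((i : ℕ) : ℤ)))) ^ r) ^ (1 / r) := by
      rw [Finset.sum_range]
      refine Real.rpow_le_rpow (Finset.sum_nonneg fun i _ ↦ Real.rpow_nonneg (hu0 _) _)
        (Finset.sum_le_sum fun i _ ↦ Real.rpow_le_rpow (hu0 _) ?_ hr0.le) (by positivity)
      exact hS.mul_fund_card_le g (by positivity) _ fun k hk ↦ ((hmem _ _).1 hk).1.le
    have h5 : (∑ i ∈ Finset.range N, x i ^ r) ^ (1 / r) ≤ 2 * |C| * S.nrm g := by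
      have h6 := mul_le_mul (le_abs_self C) h3 (apply_nonneg _ _) (abs_nonneg C)
      linarith
    have h7 : 0 ≤ ∑ i ∈ Finset.range N, x i ^ r :=
      Finset.sum_nonneg fun i _ ↦ Real.rpow_nonneg (hx0 _) _
    have h8 := Real.rpow_le_rpow (Real.rpow_nonneg h7 _) h5 hr0.le
    rwa [← Real.rpow_mul h7, one_div_mul_cancel hr0.ne', Real.rpow_one] at h8
  have hterm : ∀ j : ℤ, 0 ≤ (2 : ℝ) ^ j * S.fund (levelCard g.1 j) := fun j ↦
    mul_nonneg (by positivity) (S.fund_nonneg _)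
  refine ENNReal.summable.tsum_le_of_sum_le fun s ↦ ?_
  obtain ⟨a, ha⟩ := s.bddBelow
  obtain ⟨b, hb⟩ := s.bddAbove
  -- Long enough for the window from `a` to contain `s` and to end at or above level `M`.
  set N : ℕ := (b - a).toNat + 1 + (M - a).toNat with hN
  have hsub : s ⊆ (Finset.range N).image fun i : ℕ ↦ a + (i : ℤ) := fun j hj ↦ by
    have h1 := ha hj
    have h2 := hb hj
    exact Finset.mem_image.2 ⟨(j - a).toNat, Finset.mem_range.2 (by omega), by omega⟩
  refine (Finset.sum_le_sum_of_subset hsub).trans ?_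
  rw [Finset.sum_image fun i _ j _ h ↦ by simpa using h]
  have h1 := ENNReal.ofReal_le_ofReal (hfinite a N (by omega))
  rw [ENNReal.ofReal_sum_of_nonneg fun i _ ↦ Real.rpow_nonneg (hterm _) _,
    ← ENNReal.ofReal_rpow_of_nonneg (by positivity) hr0.le,
    ENNReal.ofReal_mul (by positivity)] at h1
  refine le_trans (le_of_eq (Finset.sum_congr rfl fun i _ ↦ ?_)) h1
  exact ENNReal.ofReal_rpow_of_nonneg (hterm _) hr0.le

end SequenceSpace

/-! ### Coordinates, decomposition and injectivity in the completed space. -/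

section DKKCoordinates

variable {𝕜 : Type*} [RCLike 𝕜] {E : Type*} [NormedAddCommGroup E] [NormedSpace 𝕜 E]
variable (B : SchauderBasis 𝕜 E) (S : SequenceSpace 𝕜) (σ : OrderedPartition)

theorem avgProj_apply (f : ℕ →₀ 𝕜) (j : ℕ) :
    avgProj S σ f j =
      (((S.fund (σ.part (σ.index j)).card)⁻¹ : ℝ) : 𝕜) * dkkCoeff S σ f (σ.index j) := by
  classical
  have hv : ∀ n, dkkVec S σ n j =
      if n = σ.index j then (((S.fund (σ.part n).card)⁻¹ : ℝ) : 𝕜) else 0 := by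
    intro n
    have h1 : (∑ i ∈ σ.part n, Finsupp.single i (1 : 𝕜)) j = if j ∈ σ.part n then 1 else 0 := by
      simp [Finsupp.finsetSum_apply, Finsupp.single_apply]
    have h2 : j ∈ σ.part n ↔ n = σ.index j :=
      ⟨fun h ↦ (σ.index_eq h).symm, fun h ↦ h ▸ σ.mem_part_index j⟩
    rw [dkkVec, Finsupp.smul_apply, h1, smul_eq_mul]
    simp [h2]
  rw [avgProj, LinearMap.comp_apply, Finsupp.linearCombination_apply, Finsupp.sum_apply,
    Finsupp.sum]
  simp only [Finsupp.smul_apply, hv, smul_eq_mul, mul_ite, mul_zero]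
  rw [Finset.sum_ite_eq']
  split_ifs with h
  · exact mul_comm _ _
  · rw [Finsupp.notMem_support_iff.1 h, mul_zero]

theorem apply_eq_avgProjCompl_add (f : ℕ →₀ 𝕜) (j : ℕ) :
    f j = avgProjCompl S σ f j +
      (((S.fund (σ.part (σ.index j)).card)⁻¹ : ℝ) : 𝕜) * dkkCoeff S σ f (σ.index j) := by
  rw [← avgProj_apply, avgProjCompl]
  simp

theorem SchauderBasis.coord_linearCombination (c : ℕ →₀ 𝕜) (n : ℕ) :
    B.coord n (Finsupp.linearCombination 𝕜 B.basis c) = c n := by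
  classical
  rw [Finsupp.linearCombination_apply, Finsupp.sum, map_sum]
  simp only [map_smul, B.ortho, Pi.single_apply, smul_eq_mul, mul_ite, mul_one, mul_zero]
  rw [Finset.sum_ite_eq]
  split_ifs with h
  · rfl
  · exact (Finsupp.notMem_support_iff.1 h).symm

variable {B S σ} in
/-- The finitely supported sequence underlying an element of `DKKPre B S σ`. -/
def DKKPre.toFinsupp (f : DKKPre B S σ) : ℕ →₀ 𝕜 := f

theorem DKKPre.norm_eq (f : DKKPre B S σ) : ‖f‖ = dkkNorm B S σ f := rfl

/-- The map `f ↦ ∑ₙ v_n^*(f) x_n` on `c₀₀`. -/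
noncomputable def DKKPre.synth : DKKPre B S σ →L[𝕜] E :=
  LinearMap.mkContinuous
    (Finsupp.linearCombination 𝕜 B.basis ∘ₗ dkkCoeff S σ : (ℕ →₀ 𝕜) →ₗ[𝕜] E) 1 fun f ↦ by
      rw [one_mul]
      exact le_add_of_nonneg_left (apply_nonneg S.nrm _)

/-- The `j`-th coordinate functional on `c₀₀`. -/
noncomputable def DKKPre.coord (j : ℕ) : StrongDual 𝕜 (DKKPre B S σ) :=
  LinearMap.mkContinuous (Finsupp.lapply j : (ℕ →₀ 𝕜) →ₗ[𝕜] 𝕜)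
    -- The `1` bounds the coordinate of the `Q_σ` part in `S`; the other term bounds the averaged
    -- part through the basis functional of its block.
    (1 + (S.fund (σ.part (σ.index j)).card)⁻¹ * ‖B.coord (σ.index j)‖) fun f ↦ by
      have h0 := S.fund_nonneg (σ.part (σ.index j)).card
      have h1 : S.nrm (S.ofFinsupp (avgProjCompl S σ f)) ≤ ‖f‖ :=
        le_add_of_nonneg_right (norm_nonneg _)
      have h2 : ‖Finsupp.linearCombination 𝕜 B.basis (dkkCoeff S σ f)‖ ≤ ‖f‖ :=
        le_add_of_nonneg_left (apply_nonneg S.nrm _)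
      have h3 := S.norm_coord_le (S.ofFinsupp (avgProjCompl S σ f)) j
      rw [S.ofFinsupp_apply] at h3
      have h4 := ((B.coord (σ.index j)).le_opNorm
        (Finsupp.linearCombination 𝕜 B.basis (dkkCoeff S σ f))).trans
        (mul_le_mul_of_nonneg_left h2 (norm_nonneg _))
      rw [SchauderBasis.coord_linearCombination] at h4
      change ‖DKKPre.toFinsupp f j‖ ≤ _
      rw [apply_eq_avgProjCompl_add S σ f.toFinsupp j, add_mul, one_mul, mul_assoc]
      refine (norm_add_le _ _).trans (add_le_add (h3.trans h1) ?_)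
      rw [norm_mul, RCLike.norm_of_nonneg (inv_nonneg.2 h0)]
      exact mul_le_mul_of_nonneg_left h4 (inv_nonneg.2 h0)

/-- The `j`-th coordinate functional on `Y[X, S, σ]`. -/
noncomputable def DKKSpace.coord (j : ℕ) : StrongDual 𝕜 (DKKSpace B S σ) :=
  (DKKPre.coord B S σ j).extend UniformSpace.Completion.toComplL

theorem DKKSpace.coord_coe (j : ℕ) (f : DKKPre B S σ) :
    DKKSpace.coord B S σ j f = f.toFinsupp j :=
  (DKKPre.coord B S σ j).extend_eq UniformSpace.Completion.denseRange_coe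
    (UniformSpace.Completion.isUniformInducing_coe _) f

/-- The biorthogonal system of the unit vectors of `Y[X, S, σ]`. -/
noncomputable def DKKSpace.unitSystem : BiorthogonalSystem 𝕜 (DKKSpace B S σ) where
  vec := DKKSpace.unit B S σ
  dual := DKKSpace.coord B S σ
  ortho n k := by
    refine (DKKSpace.coord_coe B S σ n _).trans ((Finsupp.single_apply (a := k)).trans ?_)
    simp [eq_comm]

variable [CompleteSpace E]

/-- The continuous extension of `f ↦ ∑ₙ v_n^*(f) x_n` to `Y[X, S, σ]`. -/
noncomputable def DKKSpace.synth : DKKSpace B S σ →L[𝕜] E :=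
  (DKKPre.synth B S σ).extend UniformSpace.Completion.toComplL

theorem DKKSpace.synth_coe (f : DKKPre B S σ) :
    DKKSpace.synth B S σ f = Finsupp.linearCombination 𝕜 B.basis (dkkCoeff S σ f) :=
  (DKKPre.synth B S σ).extend_eq UniformSpace.Completion.denseRange_coe
    (UniformSpace.Completion.isUniformInducing_coe _) f

/-- Along finitely supported approximations of `y`, the `Q_σ` parts are Cauchy in `S`, because its
norm is one summand of the norm. Completeness gives `g`, and both the norm formula and the
coordinate formula pass to the limit. -/
theorem DKKSpace.exists_decomposition (y : DKKSpace B S σ) :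
    ∃ g : S.carrier, S.nrm g + ‖DKKSpace.synth B S σ y‖ = ‖y‖ ∧
      ∀ j, DKKSpace.coord B S σ j y = g.1 j +
        (((S.fund (σ.part (σ.index j)).card)⁻¹ : ℝ) : 𝕜) *
          B.coord (σ.index j) (DKKSpace.synth B S σ y) := by
  obtain ⟨f, hf⟩ : ∃ f : ℕ → DKKPre B S σ,
      Tendsto (fun k ↦ (f k : DKKSpace B S σ)) atTop (𝓝 y) := by
    obtain ⟨u, hu, hlim⟩ := mem_closure_iff_seq_limit.1
      (UniformSpace.Completion.denseRange_coe (α := DKKPre B S σ) y)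
    choose f hf using hu
    exact ⟨f, by simpa only [hf] using hlim⟩
  set q : ℕ → S.carrier := fun k ↦ S.ofFinsupp (avgProjCompl S σ (f k)) with hq
  obtain ⟨g, hg⟩ := S.complete q fun ε hε ↦ by
    obtain ⟨N, hN⟩ := Metric.cauchySeq_iff.1 hf.cauchySeq ε hε
    refine ⟨N, fun m n hm hn ↦ lt_of_le_of_lt ?_ (hN m hm n hn)⟩
    rw [UniformSpace.Completion.dist_eq, dist_eq_norm, DKKPre.norm_eq]
    refine le_trans (le_of_eq ?_) (le_add_of_nonneg_right (norm_nonneg _))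
    rw [hq]
    congr 1
    rw [← map_sub]
    exact congrArg _ (map_sub (avgProjCompl S σ) (f m) (f n)).symm
  have hsynth : Tendsto (fun k ↦ Finsupp.linearCombination 𝕜 B.basis (dkkCoeff S σ (f k))) atTop
      (𝓝 (DKKSpace.synth B S σ y)) := by
    have h := ((DKKSpace.synth B S σ).continuous.tendsto y).comp hf
    exact h.congr fun k ↦ DKKSpace.synth_coe B S σ (f k)
  have hnrm : Tendsto (fun k ↦ S.nrm (q k)) atTop (𝓝 (S.nrm g)) := by
    rw [tendsto_iff_norm_sub_tendsto_zero]
    exact squeeze_zero (fun _ ↦ norm_nonneg _) (fun k ↦ abs_sub_map_le_sub S.nrm _ _) hg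
  refine ⟨g, ?_, fun j ↦ ?_⟩
  · refine tendsto_nhds_unique (hnrm.add hsynth.norm) (hf.norm.congr fun k ↦ ?_)
    rw [UniformSpace.Completion.norm_coe]
    rfl
  · have h1 : Tendsto (fun k ↦ (f k).toFinsupp j) atTop (𝓝 (DKKSpace.coord B S σ j y)) :=
      (((DKKSpace.coord B S σ j).continuous.tendsto y).comp hf).congr fun k ↦
        DKKSpace.coord_coe B S σ j (f k)
    have h2 : Tendsto (fun k ↦ dkkCoeff S σ (f k) (σ.index j)) atTop
        (𝓝 (B.coord (σ.index j) (DKKSpace.synth B S σ y))) :=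
      (((B.coord (σ.index j)).continuous.tendsto _).comp hsynth).congr fun k ↦
        SchauderBasis.coord_linearCombination B _ _
    have h3 : Tendsto (fun k ↦ (q k).1 j) atTop (𝓝 (g.1 j)) := by
      rw [tendsto_iff_norm_sub_tendsto_zero]
      exact squeeze_zero (fun _ ↦ norm_nonneg _) (fun k ↦ S.norm_coord_le (q k - g) j) hg
    refine tendsto_nhds_unique h1 ((h3.add (h2.const_mul _)).congr fun k ↦ ?_)
    rw [hq, S.ofFinsupp_apply]
    exact (apply_eq_avgProjCompl_add S σ (f k) j).symm

/-- Both sides are continuous and agree by definition on `c₀₀`. Thus the coefficients of `y`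
determine its component in `X`. -/
theorem DKKSpace.coord_synth (n : ℕ) (y : DKKSpace B S σ) :
    B.coord n (DKKSpace.synth B S σ y) =
      ((S.fund (σ.part n).card / (σ.part n).card : ℝ) : 𝕜) *
        ∑ j ∈ σ.part n, DKKSpace.coord B S σ j y := by
  induction y using UniformSpace.Completion.induction_on with
  | hp => exact isClosed_eq (by fun_prop) (by fun_prop)
  | ih f =>
    simp only [DKKSpace.synth_coe, DKKSpace.coord_coe, SchauderBasis.coord_linearCombination]
    rfl

theorem DKKSpace.coeff_injective :
    Function.Injective (DKKSpace.unitSystem B S σ).coeff := by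
  have key : ∀ y : DKKSpace B S σ, (∀ j, DKKSpace.coord B S σ j y = 0) → y = 0 := by
    intro y hy
    obtain ⟨g, hnorm, hcoord⟩ := DKKSpace.exists_decomposition B S σ y
    have hcoef : ∀ n, B.coord n (DKKSpace.synth B S σ y) = 0 := by
      intro n
      rw [DKKSpace.coord_synth, Finset.sum_eq_zero fun j _ ↦ hy j, mul_zero]
    have hx : DKKSpace.synth B S σ y = 0 := by
      refine (B.expansion _).unique ?_
      simp only [hcoef, zero_smul]
      exact hasSum_zero
    have hg : g = 0 := by
      ext j
      have := hcoord j
      rw [hy, hcoef, mul_zero, add_zero] at this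
      exact this.symm
    rw [← norm_eq_zero, ← hnorm, hx, hg]
    simp
  intro y z hyz
  refine sub_eq_zero.1 (key _ fun j ↦ ?_)
  rw [map_sub, sub_eq_zero]
  exact congrFun hyz j

end DKKCoordinates

/-! ### The Lorentz bound. -/

theorem tendsto_zero_of_tsum_enorm_rpow_ne_top {𝕜 : Type*} [RCLike 𝕜] {r : ℝ} (hr : 0 < r)
    {c : ℕ → 𝕜} (hc : ∑' n, ‖c n‖ₑ ^ r ≠ ∞) : Tendsto c atTop (𝓝 0) := by
  have h := ENNReal.tendsto_atTop_zero_of_tsum_ne_top hc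
  have h2 := (ENNReal.continuous_rpow_const (y := 1 / r)).tendsto 0 |>.comp h
  rw [tendsto_zero_iff_enorm_tendsto_zero]
  rw [ENNReal.zero_rpow_of_pos (by positivity)] at h2
  refine h2.congr fun n ↦ ?_
  rw [Function.comp_apply, ← ENNReal.rpow_mul, mul_one_div_cancel hr.ne', ENNReal.rpow_one]

theorem DKKSpace.isBesselian_lorentz {𝕜 : Type*} [RCLike 𝕜]
    {X : Type*} [NormedAddCommGroup X] [NormedSpace 𝕜 X] [CompleteSpace X]
    (B : SchauderBasis 𝕜 X) (S : SequenceSpace 𝕜) (hS : S.IsSubsymmetric) (σ : OrderedPartition)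
    (hσ : ∃ D : ℝ, ∀ m : ℕ,
      ∑ n ∈ Finset.range m, ((σ.part n).card : ℝ) ≤ D * (σ.part m).card)
    (r : ℝ) (hr : 1 < r) (hSr : S.LowerEstimate r)
    (hB : (BiorthogonalSystem.ofSchauderBasis B).IsBesselian (ellENorm r)) :
    (DKKSpace.unitSystem B S σ).IsBesselian
      (lorentzENorm r (fun n ↦ S.fund (n + 1) - S.fund n)) := by
  have hr0 : 0 < r := by linarith
  obtain ⟨D, hD⟩ := hσ
  obtain ⟨C₁, hC₁⟩ := SequenceSpace.dyadicLevelSum_le_of_lowerEstimate hS hr hSr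
  obtain ⟨C₂, hC₂⟩ := hB
  -- The extra `1` accounts for block `m` itself, which the growth hypothesis leaves out.
  set K : ℕ := ⌈D⌉₊ + 1 with hKdef
  have hK : ∀ m, ∑ n ∈ Finset.range (m + 1), (σ.part n).card ≤ K * (σ.part m).card := by
    intro m
    have h1 := (hD m).trans (mul_le_mul_of_nonneg_right (Nat.le_ceil D) (Nat.cast_nonneg _))
    rw [Finset.sum_range_succ, hKdef, add_mul, one_mul]
    gcongr
    exact_mod_cast h1
  have hpos : ∀ n, 0 < n → 0 < S.fund n := fun n hn ↦ one_pos.trans_le (S.one_le_fund hn)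
  set M : ℝ≥0∞ := 2 ^ r * (2 ^ r * 2 ^ (r - 1) * ((C₁ : ℝ≥0∞) ^ r + K ^ r * (2 * C₂ ^ r))) with hM
  have hMtop : M ≠ ∞ := by
    have h2 : (2 : ℝ≥0∞) ^ r ≠ ∞ := ENNReal.rpow_ne_top_of_nonneg hr0.le (by simp)
    have h3 : (2 : ℝ≥0∞) ^ (r - 1) ≠ ∞ := ENNReal.rpow_ne_top_of_nonneg (by linarith) (by simp)
    have h4 : (C₁ : ℝ≥0∞) ^ r ≠ ∞ := ENNReal.rpow_ne_top_of_nonneg hr0.le (by simp)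
    have h5 : (C₂ : ℝ≥0∞) ^ r ≠ ∞ := ENNReal.rpow_ne_top_of_nonneg hr0.le (by simp)
    have h6 : (K : ℝ≥0∞) ^ r ≠ ∞ := ENNReal.rpow_ne_top_of_nonneg hr0.le (by simp)
    finiteness
  refine ⟨(M ^ (1 / r)).toNNReal, fun y ↦ ?_⟩
  rw [ENNReal.coe_toNNReal (ENNReal.rpow_ne_top_of_nonneg (by positivity) hMtop),
    ← ENNReal.rpow_le_rpow_iff hr0, ENNReal.mul_rpow_of_nonneg _ _ hr0.le, ← ENNReal.rpow_mul,
    one_div_mul_cancel hr0.ne', ENNReal.rpow_one]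
  obtain ⟨g, hnorm, hcoord⟩ := DKKSpace.exists_decomposition B S σ y
  set x := DKKSpace.synth B S σ y
  set c : ℕ → 𝕜 := fun n ↦ B.coord n x with hc
  set h : ℕ → 𝕜 := fun j ↦
    (((S.fund (σ.part (σ.index j)).card)⁻¹ : ℝ) : 𝕜) * c (σ.index j) with hh
  have hF : (DKKSpace.unitSystem B S σ).coeff y = g.1 + h := funext hcoord
  have hcsum : ∑' n, ‖c n‖ₑ ^ r ≤ (C₂ : ℝ≥0∞) ^ r * ‖x‖ₑ ^ r := by
    have h1 := ENNReal.rpow_le_rpow (hC₂ x) hr0.le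
    rw [ellENorm, ← ENNReal.rpow_mul, one_div_mul_cancel hr0.ne', ENNReal.rpow_one,
      ENNReal.mul_rpow_of_nonneg _ _ hr0.le] at h1
    exact h1
  have hc0 : Tendsto c atTop (𝓝 0) := by
    refine tendsto_zero_of_tsum_enorm_rpow_ne_top hr0 (ne_top_of_le_ne_top ?_ hcsum)
    exact ENNReal.mul_ne_top (ENNReal.rpow_ne_top_of_nonneg hr0.le ENNReal.coe_ne_top)
      (ENNReal.rpow_ne_top_of_nonneg hr0.le enorm_ne_top)
  have hhnorm : ∀ j, ‖h j‖ = ‖c (σ.index j)‖ / S.fund (σ.part (σ.index j)).card := fun j ↦ by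
    rw [hh, norm_mul, RCLike.norm_of_nonneg (inv_nonneg.2 (S.fund_nonneg _)), inv_mul_eq_div]
  -- Dividing by `Λ ≥ 1` only decreases moduli, and the block index tends to infinity, so `h`
  -- inherits nullity from `c`.
  have hh0 : Tendsto h atTop (𝓝 0) := by
    rw [tendsto_zero_iff_norm_tendsto_zero]
    refine squeeze_zero (fun _ ↦ norm_nonneg _) (fun j ↦ ?_)
      ((tendsto_zero_iff_norm_tendsto_zero.1 hc0).comp σ.tendsto_index)
    rw [hhnorm]
    exact div_le_self (norm_nonneg _) (S.one_le_fund (σ.card_pos _))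
  have hg0 := S.tendsto_coord_zero g
  have hsum0 : Tendsto (g.1 + h) atTop (𝓝 0) := by
    rw [← add_zero (0 : 𝕜)]
    exact hg0.add hh0
  have hgy : ENNReal.ofReal (S.nrm g) ≤ ‖y‖ₑ := by
    rw [← ofReal_norm, ← hnorm]
    exact ENNReal.ofReal_le_ofReal (le_add_of_nonneg_right (norm_nonneg _))
  have hxy : ‖x‖ₑ ≤ ‖y‖ₑ := by
    rw [← ofReal_norm, ← ofReal_norm, ← hnorm]
    exact ENNReal.ofReal_le_ofReal (le_add_of_nonneg_left (apply_nonneg _ _))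
  have hΦg : dyadicLevelSum r S.fund g.1 ≤ (C₁ : ℝ≥0∞) ^ r * ‖y‖ₑ ^ r := by
    rw [← ENNReal.mul_rpow_of_nonneg _ _ hr0.le]
    exact (hC₁ g).trans (ENNReal.rpow_le_rpow (mul_le_mul' le_rfl hgy) hr0.le)
  have hΦh : dyadicLevelSum r S.fund h ≤ (K : ℝ≥0∞) ^ r * (2 * (C₂ ^ r * ‖y‖ₑ ^ r)) := by
    refine (dyadicLevelSum_blocks_le hr S.fund_mono S.fund_zero hS.fund_add_le hpos σ hK hh0
      hhnorm).trans ?_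
    gcongr
    exact hcsum.trans (by gcongr)
  rw [hF]
  calc _ ≤ 2 ^ r * dyadicLevelSum r S.fund (g.1 + h) :=
        lorentzENorm_rpow_le_dyadicLevelSum hr S.fund_mono S.fund_zero hpos hsum0
    _ ≤ 2 ^ r * (2 ^ r * 2 ^ (r - 1) *
          (dyadicLevelSum r S.fund g.1 + dyadicLevelSum r S.fund h)) := by
        gcongr
        exact dyadicLevelSum_add_le hr S.fund_mono hS.fund_add_le S.fund_nonneg hg0 hh0
    _ ≤ 2 ^ r * (2 ^ r * 2 ^ (r - 1) *
          ((C₁ : ℝ≥0∞) ^ r * ‖y‖ₑ ^ r + (K : ℝ≥0∞) ^ r * (2 * (C₂ ^ r * ‖y‖ₑ ^ r)))) := by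
        gcongr
    _ = M * ‖y‖ₑ ^ r := by
        rw [hM]
        ring

theorem mainTheorem11 {𝕜 : Type*} [RCLike 𝕜]
    {X : Type*} [NormedAddCommGroup X] [NormedSpace 𝕜 X] [CompleteSpace X]
    (B : SchauderBasis 𝕜 X)
    (S : SequenceSpace 𝕜) (hS : S.IsSubsymmetric)
    (σ : OrderedPartition)
    (hσ : ∃ D : ℝ, ∀ m : ℕ,
      ∑ n ∈ Finset.range m, ((σ.part n).card : ℝ) ≤ D * (σ.part m).card)
    (r : ℝ) (hr : 1 < r)
    (hSr : S.LowerEstimate r)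
    (hB : (BiorthogonalSystem.ofSchauderBasis B).IsBesselian (ellENorm r))
    (hURP : HasURP S.fund) :
    ∃ O : BiorthogonalSystem 𝕜 (DKKSpace B S σ),
      O.vec = DKKSpace.unit B S σ ∧
      O.IsBesselian (lorentzENorm r (fun n ↦ S.fund (n + 1) - S.fund n)) ∧
      Function.Injective O.coeff :=
  ⟨DKKSpace.unitSystem B S σ, rfl,
    DKKSpace.isBesselian_lorentz B S hS σ hσ r hr hSr hB, DKKSpace.coeff_injective B S σ⟩
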